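/- Let $n, N$ be nonnegative integers and let $(\Delta,\mathcal F)$ be a measurable space (for instance a subset $\Delta\subseteq\mathbb R^m$ with its Borel sets); give $\Delta^N$ the product $\sigma$-algebra and $\mathbb R^n$ its Borel $\sigma$-algebra. Let $\mathcal X\subset\mathbb R^n$ be compact and convex, let $J:\mathbb R^n\to\mathbb R$ be lower semicontinuous, and let $g:\mathbb R^n\times\Delta\to\mathbb R$ be such that $x\mapsto g(x,\delta)$ is convex and lower semicontinuous for every $\delta\in\Delta$ and $\delta\mapsto g(x,\delta)$ is measurable for every $x\in\mathbb R^n$. For $\omega=(\delta_1,\dots,\delta_N)\in\Delta^N$ consider the scenario program $$\mathrm{SP}[\omega]:\quad \min_{x\in\mathcal X} J(x)\quad\text{subject to } g(x,\delta_i)\le 0 \text{ for all } i=1,\dots,N,$$ let $J^\star(\omega)\in\mathbb R\cup\{\pm\infty\}$ be its optimal value (the infimum of $J$ over the feasible points, equal to $+\infty$ if there are none) and let $\mathcal X^\star(\omega)\subseteq\mathcal X$ be its set of optimizers (the feasible points at which $J$ is minimal among all feasible points). Call a set-valued mapping $M:\Delta^N\rightrightarrows\mathbb R^n$ measurable if $\{\omega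 : M(\omega)\cap O\ne\varnothing\}$ is measurable for every open $O\subseteq\mathbb R^n$. Then: 1. $J^\star$ is measurable, and whenever $\mathrm{SP}[\omega]$ is feasible the value $J^\star(\omega)$ is finite and attained, so that $\mathcal X^\star(\omega)\neq\varnothing$. 2. $\mathcal X^\star$ is closed-valued and measurable. 3. The set $F=\{\omega\in\Delta^N : \mathrm{SP}[\omega]\text{ is feasible}\}$ is measurable, and $\mathcal X^\star$ admits a measurable selection on it: there is a measurable mapping $x^\star:F\to\mathcal X$ with $x^\star(\omega)\in\mathcal X^\star(\omega)$ for all $\omega\in F$. In particular, if $\mathrm{SP}[\omega]$ is feasible for every $\omega\in\Delta^N$, then $J^\star$ is a measurable mapping $\Delta^N\to\mathbb R$, and there is a measurable mapping $x^\star:\Delta^N\to\mathcal X$ with $x^\star(\omega)\in\mathcal X^\star(\omega)$ for all $\omega\in\Delta^N$. -/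

import Mathlib

/-- The feasible set of the scenario program with admissible set `X`, constraint function `g` and
multi-sample `ω = (δ₁, …, δ_N)`: all `x ∈ X` with `g x δᵢ ≤ 0` for every `i`. -/
def scenarioFeasibleSet {E D : Type*} {N : ℕ} (X : Set E) (g : E → D → ℝ)
    (ω : Fin N → D) : Set E :=
  {x | x ∈ X ∧ ∀ i, g x (ω i) ≤ 0}

/-- The optimal value `inf {J x | x feasible}` of the scenario program, as an extended real number
(it is `⊤` if the program is infeasible). -/
noncomputable def scenarioOptimalValue {E D : Type*} {N : ℕ} (X : Set E) (J : E → ℝ)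
    (g : E → D → ℝ) (ω : Fin N → D) : EReal :=
  ⨅ x ∈ scenarioFeasibleSet X g ω, (J x : EReal)

/-- The set of (global) optimizers of the scenario program. -/
def scenarioOptimizerSet {E D : Type*} {N : ℕ} (X : Set E) (J : E → ℝ)
    (g : E → D → ℝ) (ω : Fin N → D) : Set E :=
  {x | x ∈ scenarioFeasibleSet X g ω ∧ ∀ y ∈ scenarioFeasibleSet X g ω, J x ≤ J y}

/-- Measurability of a set-valued mapping `M : Ω ⇉ E`: for every open `O`, the inverse image
`M⁻¹(O) = {ω | M ω ∩ O ≠ ∅}` is measurable. -/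
def MeasurableSetValued {Ω E : Type*} [MeasurableSpace Ω] [TopologicalSpace E]
    (M : Ω → Set E) : Prop :=
  ∀ O : Set E, IsOpen O → MeasurableSet {ω | (M ω ∩ O).Nonempty}

open Set

/-! A finite convex function on `ℝⁿ` is continuous, so the feasible sets are compact and depend on
`ω` through finitely many Carathéodory constraints; hitting a closed set then reduces to countably
many measurable conditions. The class `MeasurableCompactValued` is stable under minimizing a lower
semicontinuous function (`MeasurableCompactValued.argmin`). Minimizing `J` gives the optimizers;
minimizing all coordinates in turn then shrinks each nonempty value to one point, which is the
measurable selection. -/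

/-- The minimizers of `h` on `s`. -/
def argminOn {E : Type*} (h : E → ℝ) (s : Set E) : Set E :=
  {x | x ∈ s ∧ ∀ y ∈ s, h x ≤ h y}

theorem argminOn_subset {E : Type*} (h : E → ℝ) (s : Set E) : argminOn h s ⊆ s :=
  fun _ hx => hx.1

/-- The infimum of `h` on `s` as an extended real number. -/
noncomputable def einfOn {E : Type*} (h : E → ℝ) (s : Set E) : EReal :=
  ⨅ x ∈ s, (h x : EReal)

theorem einfOn_eq_of_mem_argminOn {E : Type*} {h : E → ℝ} {s : Set E} {x : E}
    (hx : x ∈ argminOn h s) : einfOn h s = (h x : EReal) :=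
  le_antisymm (iInf₂_le x hx.1) (le_iInf₂ fun y hy => EReal.coe_le_coe_iff.2 (hx.2 y hy))

theorem argminOn_nonempty {E : Type*} [TopologicalSpace E] {h : E → ℝ}
    (hh : LowerSemicontinuous h) {s : Set E} (hs : IsCompact s) (hne : s.Nonempty) :
    (argminOn h s).Nonempty := by
  obtain ⟨x, hx, hmin⟩ := (hh.lowerSemicontinuousOn s).exists_isMinOn hne hs
  exact ⟨x, hx, fun y hy => hmin hy⟩

theorem isCompact_argminOn {E : Type*} [TopologicalSpace E] {h : E → ℝ}
    (hh : LowerSemicontinuous h) {s : Set E} (hs : IsCompact s) :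
    IsCompact (argminOn h s) := by
  rcases (argminOn h s).eq_empty_or_nonempty with he | ⟨x, hx⟩
  · rw [he]; exact isCompact_empty
  · have : argminOn h s = s ∩ h ⁻¹' Iic (h x) := by
      ext y
      exact ⟨fun hy => ⟨hy.1, hy.2 x hx.1⟩, fun hy => ⟨hy.1, fun z hz => hy.2.trans (hx.2 z hz)⟩⟩
    rw [this]
    exact hs.inter_right (hh.isClosed_preimage _)

theorem einfOn_le_coe_iff {E : Type*} [TopologicalSpace E] {h : E → ℝ}
    (hh : LowerSemicontinuous h) {s : Set E} (hs : IsCompact s) (a : ℝ) :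
    einfOn h s ≤ a ↔ (s ∩ h ⁻¹' Iic a).Nonempty := by
  constructor
  · intro hle
    rcases s.eq_empty_or_nonempty with rfl | hne
    · simp [einfOn] at hle
    · obtain ⟨x, hx⟩ := argminOn_nonempty hh hs hne
      rw [einfOn_eq_of_mem_argminOn hx] at hle
      exact ⟨x, hx.1, EReal.coe_le_coe_iff.1 hle⟩
  · rintro ⟨x, hx, hxa⟩
    exact (iInf₂_le x hx).trans (EReal.coe_le_coe_iff.2 hxa)

theorem einfOn_ne_bot {E : Type*} [TopologicalSpace E] {h : E → ℝ}
    (hh : LowerSemicontinuous h) {s : Set E} (hs : IsCompact s) : einfOn h s ≠ ⊥ := by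
  rcases s.eq_empty_or_nonempty with rfl | hne
  · simp [einfOn]
  · obtain ⟨x, hx⟩ := argminOn_nonempty hh hs hne
    rw [einfOn_eq_of_mem_argminOn hx]
    exact EReal.coe_ne_bot _

/-- A minimizer over the compact set `s ∩ K` is a minimizer over `s` as soon as the two infima
agree. The nonemptiness clause matters only for empty `s`, where both infima are `⊤`. -/
theorem argminOn_inter_nonempty_iff {E : Type*} [TopologicalSpace E] {h : E → ℝ}
    (hh : LowerSemicontinuous h) {s K : Set E} (hs : IsCompact s) (hK : IsClosed K) :
    (argminOn h s ∩ K).Nonempty ↔ (s ∩ K).Nonempty ∧ einfOn h (s ∩ K) ≤ einfOn h s := by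
  constructor
  · rintro ⟨x, hx, hxK⟩
    refine ⟨⟨x, hx.1, hxK⟩, ?_⟩
    rw [einfOn_eq_of_mem_argminOn hx]
    exact iInf₂_le x (⟨hx.1, hxK⟩ : x ∈ s ∩ K)
  · rintro ⟨hne, hle⟩
    obtain ⟨x, hx⟩ := argminOn_nonempty hh (hs.inter_right hK) hne
    rw [einfOn_eq_of_mem_argminOn hx] at hle
    exact ⟨x, ⟨hx.1.1, fun y hy => EReal.coe_le_coe_iff.1 (hle.trans (iInf₂_le y hy))⟩, hx.1.2⟩

/-- A compact-valued set-valued mapping whose inverse images of closed sets are measurable. -/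
structure MeasurableCompactValued {Ω E : Type*} [MeasurableSpace Ω] [TopologicalSpace E]
    (M : Ω → Set E) : Prop where
  isCompact : ∀ ω, IsCompact (M ω)
  measurableSet_inter : ∀ K : Set E, IsClosed K → MeasurableSet {ω | (M ω ∩ K).Nonempty}

namespace MeasurableCompactValued

variable {Ω E : Type*} [MeasurableSpace Ω] [TopologicalSpace E] {M : Ω → Set E}

theorem measurableSet_nonempty (hM : MeasurableCompactValued M) :
    MeasurableSet {ω | (M ω).Nonempty} := by
  simpa using hM.measurableSet_inter univ isClosed_univ

theorem inter_closed (hM : MeasurableCompactValued M) {K : Set E} (hK : IsClosed K) :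
    MeasurableCompactValued fun ω => M ω ∩ K where
  isCompact ω := (hM.isCompact ω).inter_right hK
  measurableSet_inter L hL := by
    simpa only [inter_assoc] using hM.measurableSet_inter (K ∩ L) (hK.inter hL)

theorem measurable_einfOn (hM : MeasurableCompactValued M) {h : E → ℝ}
    (hh : LowerSemicontinuous h) : Measurable fun ω => einfOn h (M ω) := by
  refine measurable_of_Iic fun a => ?_
  induction a with
  | bot =>
    convert MeasurableSet.empty
    ext ω
    simpa using einfOn_ne_bot hh (hM.isCompact ω)
  | top => simp
  | coe a =>
    convert hM.measurableSet_inter _ (hh.isClosed_preimage a) using 1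
    ext ω
    exact einfOn_le_coe_iff hh (hM.isCompact ω) a

theorem argmin (hM : MeasurableCompactValued M) {h : E → ℝ} (hh : LowerSemicontinuous h) :
    MeasurableCompactValued fun ω => argminOn h (M ω) where
  isCompact ω := isCompact_argminOn hh (hM.isCompact ω)
  measurableSet_inter K hK := by
    simp only [argminOn_inter_nonempty_iff hh (hM.isCompact _) hK]
    exact (hM.measurableSet_inter K hK).inter
      (measurableSet_le ((hM.inter_closed hK).measurable_einfOn hh) (hM.measurable_einfOn hh))

/-- Successive minimization of finitely many functions leaves a set on which all are constant. -/
theorem exists_subset_constant (hM : MeasurableCompactValued M) (l : List (E → ℝ))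
    (hl : ∀ h ∈ l, LowerSemicontinuous h) :
    ∃ M' : Ω → Set E, MeasurableCompactValued M' ∧ (∀ ω, M' ω ⊆ M ω) ∧
      (∀ ω, (M ω).Nonempty → (M' ω).Nonempty) ∧
      ∀ ω, ∀ h ∈ l, ∀ x ∈ M' ω, ∀ y ∈ M' ω, h x = h y := by
  induction l with
  | nil => exact ⟨M, hM, fun _ => Subset.rfl, fun _ => id, by simp⟩
  | cons h l ih =>
    obtain ⟨M', hM', hsub, hne, hc⟩ := ih fun k hk => hl k (List.mem_cons_of_mem _ hk)
    have hh := hl h List.mem_cons_self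
    refine ⟨_, hM'.argmin hh, fun ω => (argminOn_subset _ _).trans (hsub ω),
      fun ω hω => argminOn_nonempty hh (hM'.isCompact ω) (hne ω hω), fun ω k hk x hx y hy => ?_⟩
    rcases List.mem_cons.1 hk with rfl | hk
    · exact le_antisymm (hx.2 y hy.1) (hy.2 x hx.1)
    · exact hc ω k hk x hx.1 y hy.1

/-- An open set is a countable union of compact, hence closed, sets. -/
theorem measurableSetValued [T2Space E] [LocallyCompactSpace E] [SecondCountableTopology E]
    (hM : MeasurableCompactValued M) : MeasurableSetValued M := by
  intro O hO
  have : LocallyCompactSpace O := hO.locallyCompactSpace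
  have hc : ∀ k, IsClosed ((↑) '' compactCovering O k : Set E) := fun k =>
    ((isCompact_compactCovering O k).image continuous_subtype_val).isClosed
  have hU : O = ⋃ k, ((↑) '' compactCovering O k : Set E) := by
    rw [← image_iUnion, iUnion_compactCovering, image_univ, Subtype.range_coe]
  have : {ω | (M ω ∩ O).Nonempty} =
      ⋃ k, {ω | (M ω ∩ ((↑) '' compactCovering O k : Set E)).Nonempty} := by
    ext ω
    conv_lhs => rw [hU]
    simp only [mem_ofPred_eq, inter_iUnion, nonempty_iUnion, mem_iUnion]
  rw [this]
  exact MeasurableSet.iUnion fun k => hM.measurableSet_inter _ (hc k)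

/-- A compact-valued measurable mapping into `ℝⁿ` has a measurable selection on its domain. -/
theorem exists_measurable_selection {n : ℕ} {M : Ω → Set (EuclideanSpace ℝ (Fin n))}
    (hM : MeasurableCompactValued M) :
    ∃ f : {ω // (M ω).Nonempty} → EuclideanSpace ℝ (Fin n),
      Measurable f ∧ ∀ ω, f ω ∈ M ω.1 := by
  -- With the coordinate functions as the list, points of `M' ω` share all coordinates.
  obtain ⟨M', hM', hsub, hne, hc⟩ := hM.exists_subset_constant
    (List.ofFn fun (i : Fin n) (x : EuclideanSpace ℝ (Fin n)) => x i) (by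
      intro h hh
      obtain ⟨i, rfl⟩ := (List.mem_ofFn' _ _).1 hh
      exact Continuous.lowerSemicontinuous (by fun_prop))
  have huniq : ∀ ω, ∀ x ∈ M' ω, ∀ y ∈ M' ω, x = y := fun ω x hx y hy => by
    ext i
    exact hc ω (fun x => x i) ((List.mem_ofFn' _ _).2 ⟨i, rfl⟩) x hx y hy
  choose f hf using fun ω : {ω // (M ω).Nonempty} => hne ω.1 ω.2
  refine ⟨f, measurable_of_isClosed fun K hK => ?_, fun ω => hsub _ (hf ω)⟩
  -- As `M' ω` is a singleton, `f ω ∈ K` means that `M' ω` meets `K`.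
  convert measurable_subtype_coe (hM'.measurableSet_inter K hK) using 1
  ext ω
  refine ⟨fun h => ⟨f ω, hf ω, h⟩, fun ⟨x, hx, hxK⟩ => ?_⟩
  rwa [huniq _ _ hx _ (hf ω)] at hxK

end MeasurableCompactValued

/-- Feasibility over a compact set of finitely many Carathéodory constraints is measurable. -/
theorem measurableSet_exists_forall_le_zero {Ω E ι : Type*} [MeasurableSpace Ω]
    [TopologicalSpace E] [T2Space E] [SecondCountableTopology E] [Finite ι] {C : Set E}
    (hC : IsCompact C) (G : E → ι → Ω → ℝ) (hcont : ∀ i ω, Continuous fun x => G x i ω)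
    (hmeas : ∀ x i, Measurable (G x i)) :
    MeasurableSet {ω | ∃ x ∈ C, ∀ i, G x i ω ≤ 0} := by
  obtain ⟨D, hDc, hD⟩ := TopologicalSpace.exists_countable_dense C
  -- The strict relaxed constraints are open in `x`, so a feasible point yields one in `D`;
  -- conversely, the nested compact sets of relaxed solutions have a common point.
  have heq : {ω | ∃ x ∈ C, ∀ i, G x i ω ≤ 0} =
      ⋂ k : ℕ, ⋃ d ∈ D, ⋂ i, {ω | G (d : E) i ω < 1 / ((k : ℝ) + 1)} := by
    ext ω
    simp only [mem_ofPred_eq, mem_iInter, mem_iUnion, exists_prop]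
    constructor
    · rintro ⟨x, hx, hx0⟩ k
      have hopen : IsOpen {y : C | ∀ i, G (y : E) i ω < 1 / ((k : ℝ) + 1)} := by
        simp only [ofPred_forall]
        exact isOpen_iInter_of_finite fun i =>
          isOpen_lt ((hcont i ω).comp continuous_subtype_val) continuous_const
      obtain ⟨d, hd, hdD⟩ := hD.inter_open_nonempty _ hopen
        ⟨⟨x, hx⟩, fun i => (hx0 i).trans_lt Nat.one_div_pos_of_nat⟩
      exact ⟨d, hdD, hd⟩
    · intro h
      have hcl : ∀ k : ℕ, IsClosed {x | ∀ i, G x i ω ≤ 1 / ((k : ℝ) + 1)} := fun k => by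
        simp only [ofPred_forall]
        exact isClosed_iInter fun i => isClosed_le (hcont i ω) continuous_const
      obtain ⟨x, hx⟩ := IsCompact.nonempty_iInter_of_sequence_nonempty_isCompact_isClosed
        (fun k : ℕ => C ∩ {x | ∀ i, G x i ω ≤ 1 / ((k : ℝ) + 1)})
        (fun k x hx => ⟨hx.1, fun i => (hx.2 i).trans
          (by exact_mod_cast Nat.one_div_le_one_div (α := ℝ) k.le_succ)⟩)
        (fun k => by
          obtain ⟨d, -, hd⟩ := h k
          exact ⟨d, d.2, fun i => (hd i).le⟩)
        (hC.inter_right (hcl 0)) (fun k => hC.isClosed.inter (hcl k))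
      rw [mem_iInter] at hx
      exact ⟨x, (hx 0).1, fun i =>
        ge_of_tendsto' tendsto_one_div_add_atTop_nhds_zero_nat fun k => (hx k).2 i⟩
  rw [heq]
  exact MeasurableSet.iInter fun k => MeasurableSet.biUnion hDc fun d _ =>
    MeasurableSet.iInter fun i => measurableSet_lt (hmeas d i) measurable_const

theorem measurableCompactValued_scenarioFeasibleSet {E Δ : Type*} {N : ℕ} [MeasurableSpace Δ]
    [TopologicalSpace E] [T2Space E] [SecondCountableTopology E] {X : Set E} (hX : IsCompact X)
    {g : E → Δ → ℝ} (hcont : ∀ δ, Continuous fun x => g x δ) (hmeas : ∀ x, Measurable (g x)) :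
    MeasurableCompactValued fun ω : Fin N → Δ => scenarioFeasibleSet X g ω where
  isCompact ω := by
    refine hX.inter_right (t := {x | ∀ i, g x (ω i) ≤ 0}) ?_
    simp only [ofPred_forall]
    exact isClosed_iInter fun i => isClosed_le (hcont _) continuous_const
  measurableSet_inter K hK := by
    convert measurableSet_exists_forall_le_zero (hX.inter_right hK)
      (fun x i (ω : Fin N → Δ) => g x (ω i)) (fun i ω => hcont (ω i))
      (fun x i => (hmeas x).comp (measurable_pi_apply i)) using 1
    ext ω
    exact ⟨fun ⟨x, hx, hxK⟩ => ⟨x, ⟨hx.1, hxK⟩, hx.2⟩, fun ⟨x, hx, hg⟩ => ⟨x, ⟨hx.1, hg⟩, hx.2⟩⟩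

theorem mainTheorem9 {n N : ℕ} {Δ : Type*} [MeasurableSpace Δ]
    (X : Set (EuclideanSpace ℝ (Fin n))) (hXcompact : IsCompact X) (hXconvex : Convex ℝ X)
    (J : EuclideanSpace ℝ (Fin n) → ℝ) (hJ : LowerSemicontinuous J)
    (g : EuclideanSpace ℝ (Fin n) → Δ → ℝ)
    (hgconvex : ∀ δ : Δ, ConvexOn ℝ Set.univ (fun x => g x δ))
    (hglsc : ∀ δ : Δ, LowerSemicontinuous (fun x => g x δ))
    (hgmeas : ∀ x, Measurable (fun δ : Δ => g x δ)) :
    -- the optimal value is measurable, and it is attained whenever the program is feasible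
    Measurable (fun ω : Fin N → Δ => scenarioOptimalValue X J g ω) ∧
    (∀ ω : Fin N → Δ, (scenarioFeasibleSet X g ω).Nonempty →
      ∃ x ∈ scenarioOptimizerSet X J g ω, scenarioOptimalValue X J g ω = (J x : EReal)) ∧
    -- the optimizer set mapping is closed-valued and measurable
    (∀ ω : Fin N → Δ, IsClosed (scenarioOptimizerSet X J g ω)) ∧
    MeasurableSetValued (fun ω : Fin N → Δ => scenarioOptimizerSet X J g ω) ∧
    -- it has a measurable domain and a measurable selection on it
    MeasurableSet {ω : Fin N → Δ | (scenarioFeasibleSet X g ω).Nonempty} ∧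
    (∃ xstar : {ω : Fin N → Δ // (scenarioFeasibleSet X g ω).Nonempty} → X,
      Measurable xstar ∧
      ∀ ω, (xstar ω : EuclideanSpace ℝ (Fin n)) ∈ scenarioOptimizerSet X J g ω.1) ∧
    -- if every instance is feasible, the optimal value is a measurable real-valued function and
    -- the selection is defined for all multi-samples
    ((∀ ω : Fin N → Δ, (scenarioFeasibleSet X g ω).Nonempty) →
      (∃ Jstar : (Fin N → Δ) → ℝ, Measurable Jstar ∧
        ∀ ω, scenarioOptimalValue X J g ω = (Jstar ω : EReal)) ∧
      ∃ xstar : (Fin N → Δ) → X,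
        Measurable xstar ∧
        ∀ ω, (xstar ω : EuclideanSpace ℝ (Fin n)) ∈ scenarioOptimizerSet X J g ω) := by
  have hcont : ∀ δ, Continuous fun x => g x δ := fun δ =>
    continuousOn_univ.1 ((hgconvex δ).continuousOn isOpen_univ)
  have hF := measurableCompactValued_scenarioFeasibleSet (N := N) hXcompact hcont hgmeas
  have hopt : MeasurableCompactValued fun ω : Fin N → Δ => scenarioOptimizerSet X J g ω :=
    hF.argmin hJ
  have hval : Measurable fun ω : Fin N → Δ => scenarioOptimalValue X J g ω :=
    hF.measurable_einfOn hJ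
  have hatt : ∀ ω : Fin N → Δ, (scenarioFeasibleSet X g ω).Nonempty →
      ∃ x ∈ scenarioOptimizerSet X J g ω, scenarioOptimalValue X J g ω = (J x : EReal) :=
    fun ω hω => by
      obtain ⟨x, hx⟩ := argminOn_nonempty hJ (hF.isCompact ω) hω
      exact ⟨x, hx, einfOn_eq_of_mem_argminOn hx⟩
  have hsel : ∃ xstar : {ω : Fin N → Δ // (scenarioFeasibleSet X g ω).Nonempty} → X,
      Measurable xstar ∧
      ∀ ω, (xstar ω : EuclideanSpace ℝ (Fin n)) ∈ scenarioOptimizerSet X J g ω.1 := by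
    obtain ⟨f, hf, hmem⟩ := hopt.exists_measurable_selection
    have hne : ∀ ω : {ω : Fin N → Δ // (scenarioFeasibleSet X g ω).Nonempty},
        (scenarioOptimizerSet X J g ω.1).Nonempty := fun ω =>
      argminOn_nonempty hJ (hF.isCompact ω.1) ω.2
    exact ⟨fun ω => ⟨f ⟨ω.1, hne ω⟩, (hmem ⟨ω.1, hne ω⟩).1.1⟩,
      (hf.comp (measurable_subtype_coe.subtype_mk (h := hne))).subtype_mk,
      fun ω => hmem ⟨ω.1, hne ω⟩⟩
  refine ⟨hval, hatt, fun ω => (hopt.isCompact ω).isClosed, hopt.measurableSetValued,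
    hF.measurableSet_nonempty, hsel, fun hall => ⟨⟨_, hval.ereal_toReal, fun ω => ?_⟩, ?_⟩⟩
  · obtain ⟨x, -, hx⟩ := hatt ω (hall ω)
    simp only [hx, EReal.toReal_coe]
  · obtain ⟨f, hf, hmem⟩ := hsel
    exact ⟨fun ω => f ⟨ω, hall ω⟩, hf.comp (measurable_id.subtype_mk (h := hall)),
      fun ω => hmem ⟨ω, hall ω⟩⟩
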